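/- Let $\mathfrak h$ be a complex Hilbert space with an anti-unitary involution $\Gamma$ (antilinear, $\Gamma^2=1$, $\langle\Gamma f,\Gamma g\rangle=\langle g,f\rangle$). Let $P$ be a basis projection, i.e. an orthogonal projection with $P+\Gamma P\Gamma=1$, and put $\mathfrak p=P\mathfrak h$, $P^\perp=1-P$. Let $\mathfrak q\subseteq\mathfrak h$ be a closed $\Gamma$-invariant subspace with $\mathfrak p\cap\mathfrak q=\mathfrak p\cap\mathfrak q^\perp=\{0\}$ (so that $\mathfrak p$ and $\mathfrak q$ are in generic position). Let $\varphi\colon\mathfrak q\to\mathfrak q^\perp$ be the densely defined closed linear operator with graph $\{(x,y)\in\mathfrak q\times\mathfrak q^\perp : P^\perp(x+y)=0\}$, and let $|\varphi|=(\varphi^*\varphi)^{1/2}$. Let $\beta\colon\mathfrak p\to\mathfrak p$ be the densely defined closed antilinear operator with graph $\{(Px,P\Gamma x): x\in\mathfrak q\}$, let $\beta^*$ be its adjoint, determined by $\langle y,\beta x\rangle=\langle x,\beta^*y\rangle$, and let $\Delta_{\mathfrak p}=\beta^*\beta$. All products of unbounded operators are taken on their natural domains, and $A^{1/2}$ denotes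 the unique positive self-adjoint operator $B$ with $B^2=A$; the square roots $(\varphi^*\varphi)^{1/2}$, $\Delta_{\mathfrak p}^{1/2}$ and $(1+\Delta_{\mathfrak p})^{1/2}$ exist and are unique. Then $Wx:=(1+\Delta_{\mathfrak p})^{1/2}Px$ is defined for every $x\in\mathfrak q$, and $W$ is a linear isometry from $\mathfrak q$ onto $\mathfrak p$. For every $x\in\operatorname{dom}|\varphi|$ one has $Wx\in\operatorname{dom}\Delta_{\mathfrak p}^{1/2}$ and $$W\,|\varphi|\,x=\Delta_{\mathfrak p}^{1/2}\,W x .$$ Moreover $W|\varphi|W^*=\Delta_{\mathfrak p}^{1/2}$, including equality of domains; hence $|\varphi|$ and $\Delta_{\mathfrak p}^{1/2}$ are unitarily equivalent. -/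

import Mathlib

open scoped InnerProductSpace ComplexConjugate

noncomputable section

namespace PartialOp

section Comp

variable {E F G : Type*} [AddCommGroup E] [Module ℂ E] [AddCommGroup F] [Module ℂ F]
  [AddCommGroup G] [Module ℂ G]
  {σ τ ρ : ℂ →+* ℂ} [RingHomCompTriple σ τ ρ]

/-- The product `g f` of two partially defined (semi)linear operators, on its natural domain
`{x ∈ dom f | f x ∈ dom g}`. -/
def comp (g : F →ₛₗ.[τ] G) (f : E →ₛₗ.[σ] F) : E →ₛₗ.[ρ] G where
  domain :=
    { carrier := {x | ∃ hx : x ∈ f.domain, f ⟨x, hx⟩ ∈ g.domain}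
      zero_mem' := ⟨f.domain.zero_mem, by
        have h : f ⟨0, f.domain.zero_mem⟩ = 0 := f.map_zero
        rw [h]; exact g.domain.zero_mem⟩
      add_mem' := by
        rintro x y ⟨hx, hx'⟩ ⟨hy, hy'⟩
        refine ⟨f.domain.add_mem hx hy, ?_⟩
        have h : f ⟨x + y, f.domain.add_mem hx hy⟩ = f ⟨x, hx⟩ + f ⟨y, hy⟩ :=
          f.map_add ⟨x, hx⟩ ⟨y, hy⟩
        rw [h]; exact g.domain.add_mem hx' hy'
      smul_mem' := by
        rintro c x ⟨hx, hx'⟩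
        refine ⟨f.domain.smul_mem c hx, ?_⟩
        have h : f ⟨c • x, f.domain.smul_mem c hx⟩ = σ c • f ⟨x, hx⟩ :=
          f.map_smulₛₗ c ⟨x, hx⟩
        rw [h]; exact g.domain.smul_mem _ hx' }
  toFun :=
    { toFun := fun x => g ⟨f ⟨x.1, x.2.1⟩, x.2.2⟩
      map_add' := fun x y => by
        rw [← g.map_add]
        congr 1
        exact Subtype.ext (f.map_add ⟨x.1, x.2.1⟩ ⟨y.1, y.2.1⟩)
      map_smul' := fun c x => by
        rw [← RingHomCompTriple.comp_apply (σ₁₂ := σ) (σ₂₃ := τ) (σ₁₃ := ρ), ← g.map_smulₛₗ]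
        congr 1
        exact Subtype.ext (f.map_smulₛₗ c ⟨x.1, x.2.1⟩) }

end Comp

section Hilbert

variable {E F : Type*} [NormedAddCommGroup E] [InnerProductSpace ℂ E]
  [NormedAddCommGroup F] [InnerProductSpace ℂ F]

/-- The adjoint `T*` of a densely defined antilinear operator `T`: `T* y = w` if and only if
`⟪y, T x⟫ = ⟪x, w⟫` for all `x ∈ dom T`. -/
def antiAdjoint (T : E →ₛₗ.[starRingEnd ℂ] F) (hT : Dense (T.domain : Set E)) :
    F →ₛₗ.[starRingEnd ℂ] E where
  domain :=
    { carrier := {y | ∃ w : E, ∀ x : T.domain, ⟪y, T x⟫_ℂ = ⟪(x : E), w⟫_ℂ}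
      zero_mem' := ⟨0, fun x => by simp⟩
      add_mem' := by
        rintro y z ⟨v, hv⟩ ⟨w, hw⟩
        exact ⟨v + w, fun x => by rw [inner_add_left, inner_add_right, hv, hw]⟩
      smul_mem' := by
        rintro c y ⟨v, hv⟩
        exact ⟨conj c • v, fun x => by rw [inner_smul_left, inner_smul_right, hv]⟩ }
  toFun :=
    { toFun := fun y => y.2.choose
      map_add' := fun y z => hT.eq_of_inner_right ℂ fun x hx => by
        rw [inner_add_right, ← (y + z).2.choose_spec ⟨x, hx⟩, ← y.2.choose_spec ⟨x, hx⟩,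
          ← z.2.choose_spec ⟨x, hx⟩, ← inner_add_left]
        rfl
      map_smul' := fun c y => hT.eq_of_inner_right ℂ fun x hx => by
        rw [inner_smul_right, ← (c • y).2.choose_spec ⟨x, hx⟩, ← y.2.choose_spec ⟨x, hx⟩,
          ← inner_smul_left]
        rfl }

/-- A positive self-adjoint (in general unbounded) operator. -/
def IsPositiveSelfAdjoint [CompleteSpace E] (A : E →ₗ.[ℂ] E) : Prop :=
  IsSelfAdjoint A ∧ ∀ x : A.domain, 0 ≤ RCLike.re ⟪(x : E), A x⟫_ℂ

/-- `B` is a positive self-adjoint square root of `A`: `B ^ 2 = A`, domains included. -/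
def IsPosSqrt [CompleteSpace E] (A B : E →ₗ.[ℂ] E) : Prop :=
  IsPositiveSelfAdjoint B ∧ comp B B = A

open scoped Classical in
/-- The positive self-adjoint square root `A ^ (1/2)`; it exists and is unique when `A` is positive
self-adjoint (and is `0` by convention when there is none). -/
def posSqrt [CompleteSpace E] (A : E →ₗ.[ℂ] E) : E →ₗ.[ℂ] E :=
  if h : ∃ B, IsPosSqrt A B then h.choose else 0

/-- `U A U* = B`, domains included: `x ∈ dom A` with `A x = y` if and only if `U x ∈ dom B` with
`B (U x) = U y`. -/
def Implements (U : E ≃ₗᵢ[ℂ] F) (A : E →ₗ.[ℂ] E) (B : F →ₗ.[ℂ] F) : Prop :=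
  ∀ x y : E, (x, y) ∈ A.graph ↔ (U x, U y) ∈ B.graph

/-- Unitary equivalence of (in general unbounded) operators. -/
def UnitarilyEquivalent (A : E →ₗ.[ℂ] E) (B : F →ₗ.[ℂ] F) : Prop :=
  ∃ U : E ≃ₗᵢ[ℂ] F, Implements U A B

end Hilbert

end PartialOp

/-- A complex Hilbert space `h` with an anti-unitary involution `Γ`, the range `p` of a basis
projection `P` (that is, `P + Γ P Γ = 1`), and a closed `Γ`-invariant subspace `q` such that `p` and
`q` are in generic position (`pᗮ ⊓ q = pᗮ ⊓ qᗮ = ⊥` follow from the corresponding statements for `p`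
by applying `Γ`). Closedness of `p` and `q` is stated as completeness, which is equivalent to it in `h`.
-/
structure GenericPair (h : Type*) [NormedAddCommGroup h] [InnerProductSpace ℂ h]
    [CompleteSpace h] where
  Γ : h →ₗ⋆[ℂ] h
  inner_Γ : ∀ f g : h, ⟪Γ f, Γ g⟫_ℂ = ⟪g, f⟫_ℂ
  Γ_Γ : ∀ f : h, Γ (Γ f) = f
  p : Submodule ℂ h
  q : Submodule ℂ h
  [complete_p : CompleteSpace p]
  [complete_q : CompleteSpace q]
  basis : ∀ f : h, p.starProjection f + Γ (p.starProjection (Γ f)) = f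
  Γ_mem_q : ∀ f ∈ q, Γ f ∈ q
  p_inf_q : p ⊓ q = ⊥
  p_inf_q_orthogonal : p ⊓ qᗮ = ⊥


namespace GenericPair

open PartialOp

variable {h : Type*} [NormedAddCommGroup h] [InnerProductSpace ℂ h] [CompleteSpace h]
  (S : GenericPair h)

instance : CompleteSpace S.p := S.complete_p
instance : CompleteSpace S.q := S.complete_q

/-- `q ↦ P q` as a bounded operator from `q` to `p`. -/
def Pq : S.q →L[ℂ] S.p := S.p.orthogonalProjectionOnto ∘L S.q.subtypeL

theorem Pq_apply (x : S.q) : S.Pq x = S.p.orthogonalProjectionOnto (x : h) := rfl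

/-- `Γ` as an antilinear map from `q` to `q`. -/
def Γq : S.q →ₗ⋆[ℂ] S.q where
  toFun x := ⟨S.Γ x, S.Γ_mem_q x x.2⟩
  map_add' x y := Subtype.ext (S.Γ.map_add x y)
  map_smul' c x := Subtype.ext (S.Γ.map_smulₛₗ c x)

/-- The graph of `φ`: all `(x, y) ∈ q × qᗮ` with `Pᗮ (x + y) = 0`. -/
def phiGraph : Submodule ℂ (S.q × S.qᗮ) where
  carrier := {z | S.pᗮ.starProjection ((z.1 : h) + (z.2 : h)) = 0}
  zero_mem' := by simp
  add_mem' := by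
    intro a b ha hb
    simp only [Set.mem_ofPred_eq] at ha hb ⊢
    have e : (((a + b).1 : S.q) : h) + (((a + b).2 : S.qᗮ) : h) =
        ((a.1 : h) + (a.2 : h)) + ((b.1 : h) + (b.2 : h)) := by
      simp only [Prod.fst_add, Prod.snd_add, Submodule.coe_add]; abel
    rw [e, map_add, ha, hb, add_zero]
  smul_mem' := by
    intro c a ha
    simp only [Set.mem_ofPred_eq] at ha ⊢
    have e : (((c • a).1 : S.q) : h) + (((c • a).2 : S.qᗮ) : h) =
        c • ((a.1 : h) + (a.2 : h)) := by
      simp [smul_add]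
    rw [e, map_smul, ha, smul_zero]

/-- The operator `φ` from `q` to `qᗮ`, with `φ x = y` if and only if `Pᗮ (x + y) = 0`. -/
def phi : S.q →ₗ.[ℂ] S.qᗮ := S.phiGraph.toLinearPMap

/-- `phiGraph` is a graph, so that `φ` really is given by it. -/
theorem graph_phi : S.phi.graph = S.phiGraph := by
  refine Submodule.toLinearPMap_graph_eq _ ?_
  rintro ⟨x, y⟩ hxy (hx : x = 0)
  have h1 : S.pᗮ.starProjection ((x : h) + (y : h)) = 0 := hxy
  rw [hx, Submodule.coe_zero, zero_add, Submodule.starProjection_apply_eq_zero_iff,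
    Submodule.orthogonal_orthogonal] at h1
  have h2 : (y : h) ∈ S.p ⊓ S.qᗮ := ⟨h1, y.2⟩
  rw [S.p_inf_q_orthogonal] at h2
  exact Subtype.ext ((Submodule.mem_bot ℂ).1 h2)

/-- `P` is injective on `q`. -/
theorem Pq_injective : Function.Injective S.Pq := by
  refine (injective_iff_map_eq_zero S.Pq).2 fun x hx => ?_
  have h1 : (x : h) ∈ S.pᗮ := Submodule.orthogonalProjectionOnto_eq_zero_iff.1 hx
  have h2 := S.basis x
  rw [(Submodule.starProjection_apply_eq_zero_iff S.p).2 h1, zero_add] at h2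
  have h3 : S.Γ x = S.p.starProjection (S.Γ x) := by
    conv_lhs => rw [← h2, S.Γ_Γ]
  have h4 : S.Γ x ∈ S.p ⊓ S.q :=
    ⟨by rw [h3]; exact Submodule.starProjection_apply_mem _ _, S.Γ_mem_q x x.2⟩
  rw [S.p_inf_q, Submodule.mem_bot] at h4
  apply Subtype.ext
  rw [← S.Γ_Γ x, h4, map_zero, Submodule.coe_zero]

/-- `dom φ = Q p` is dense in `q`. -/
theorem dense_phi : Dense (S.phi.domain : Set S.q) := by
  rw [Submodule.dense_iff_topologicalClosure_eq_top,
    Submodule.topologicalClosure_eq_top_iff, Submodule.eq_bot_iff]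
  intro v hv
  have hp : (v : h) ∈ S.pᗮ := by
    intro u hu
    have hmem : S.q.orthogonalProjectionOnto u ∈ S.phi.domain := by
      refine LinearPMap.mem_domain_iff.2 ⟨S.qᗮ.orthogonalProjectionOnto u, ?_⟩
      rw [graph_phi]
      change S.pᗮ.starProjection (S.q.starProjection u + S.qᗮ.starProjection u) = 0
      rw [Submodule.starProjection_add_starProjection_orthogonal,
        Submodule.starProjection_apply_eq_zero_iff, Submodule.orthogonal_orthogonal]
      exact hu
    exact (Submodule.inner_orthogonalProjectionOnto_eq_of_mem_right v u).symm.trans (hv _ hmem)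
  have h0 : S.Pq v = 0 := by
    rw [S.Pq_apply]
    exact Submodule.orthogonalProjectionOnto_eq_zero_iff.2 hp
  exact (injective_iff_map_eq_zero S.Pq).1 S.Pq_injective v h0

/-- The antilinear operator `β` in `p` with graph `{(P x, P Γ x) | x ∈ q}`. -/
def beta : S.p →ₛₗ.[starRingEnd ℂ] S.p where
  domain := LinearMap.range S.Pq.toLinearMap
  toFun := (S.Pq.toLinearMap.comp S.Γq).comp
    (LinearEquiv.ofInjective S.Pq.toLinearMap S.Pq_injective).symm.toLinearMap

theorem beta_apply (x : S.q) :
    S.beta ⟨S.Pq x, LinearMap.mem_range_self S.Pq.toLinearMap x⟩ = S.Pq (S.Γq x) := by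
  have e : (LinearEquiv.ofInjective S.Pq.toLinearMap S.Pq_injective).symm
      ⟨S.Pq x, LinearMap.mem_range_self S.Pq.toLinearMap x⟩ = x :=
    (LinearEquiv.symm_apply_eq _).2 (Subtype.ext rfl)
  exact congrArg (fun y => S.Pq (S.Γq y)) e

theorem dense_beta : Dense (S.beta.domain : Set S.p) := by
  rw [Submodule.dense_iff_topologicalClosure_eq_top,
    Submodule.topologicalClosure_eq_top_iff, Submodule.eq_bot_iff]
  intro v hv
  have hq : (v : h) ∈ S.p ⊓ S.qᗮ := by
    refine ⟨v.2, fun u hu => ?_⟩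
    have h0 := hv (S.Pq ⟨u, hu⟩) (LinearMap.mem_range_self S.Pq.toLinearMap ⟨u, hu⟩)
    change ⟪S.p.orthogonalProjectionOnto u, v⟫_ℂ = 0 at h0
    rwa [Submodule.inner_orthogonalProjectionOnto_eq_of_mem_right] at h0
  rw [S.p_inf_q_orthogonal, Submodule.mem_bot] at hq
  exact Subtype.ext hq

/-- `|φ| = (φ* φ) ^ (1/2)`, an operator in `q`. -/
def absPhi : S.q →ₗ.[ℂ] S.q := posSqrt (comp S.phi.adjoint S.phi)

/-- `Δ = β* β`, a linear operator in `p`. -/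
def Delta : S.p →ₗ.[ℂ] S.p := comp (antiAdjoint S.beta S.dense_beta) S.beta

/-- `1 + Δ`, with domain `dom Δ`. -/
def oneAddDelta : S.p →ₗ.[ℂ] S.p := (LinearMap.id : S.p →ₗ[ℂ] S.p) +ᵥ S.Delta

/-- `W x = (1 + Δ) ^ (1/2) P x`, on its natural domain in `q`. -/
def W : S.q →ₗ.[ℂ] S.p := comp (posSqrt S.oneAddDelta) (S.Pq.toLinearMap.toPMap ⊤)

end GenericPair

end

noncomputable section

namespace PartialOp

theorem mem_graph_comp {E F G : Type*} [AddCommGroup E] [Module ℂ E] [AddCommGroup F] [Module ℂ F]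
    [AddCommGroup G] [Module ℂ G] (g : F →ₗ.[ℂ] G) (f : E →ₗ.[ℂ] F) (x : E) (z : G) :
    (x, z) ∈ (comp g f : E →ₗ.[ℂ] G).graph ↔ ∃ y, (x, y) ∈ f.graph ∧ (y, z) ∈ g.graph := by
  constructor
  · intro h
    obtain ⟨⟨x', hx, hfx⟩, rfl, rfl⟩ := (LinearPMap.mem_graph_iff _).1 h
    exact ⟨f ⟨x', hx⟩, f.mem_graph ⟨x', hx⟩, g.mem_graph ⟨f ⟨x', hx⟩, hfx⟩⟩
  · rintro ⟨y, h1, h2⟩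
    obtain ⟨⟨x', hx⟩, rfl, rfl⟩ := (LinearPMap.mem_graph_iff _).1 h1
    obtain ⟨⟨y', hy⟩, hy', rfl⟩ := (LinearPMap.mem_graph_iff _).1 h2
    obtain rfl : y' = f ⟨x', hx⟩ := hy'
    exact (comp g f : E →ₗ.[ℂ] G).mem_graph ⟨x', hx, hy⟩

section Sqrt

variable {E : Type*} [NormedAddCommGroup E] [InnerProductSpace ℂ E]

/-- A pair of commuting positive bounded operators `R`, `S` with `R` injective and
`S ^ 2 + k R ^ 2 = 1`; it represents the positive self-adjoint operator `S R⁻¹`. -/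
structure IsRepresentingPair (R S : E →L[ℂ] E) (k : ℝ) : Prop where
  nonneg_left : 0 ≤ R
  nonneg_right : 0 ≤ S
  comm : Commute R S
  injective : ∀ x, R x = 0 → x = 0
  nonneg_coeff : 0 ≤ k
  add_eq : ∀ x, S (S x) + (k : ℂ) • R (R x) = x

namespace IsRepresentingPair

variable {R S : E →L[ℂ] E} {k : ℝ}

/-- The operator `S R⁻¹`, given by its graph. -/
def quotient (R S : E →L[ℂ] E) : E →ₗ.[ℂ] E :=
  (LinearMap.range (R.toLinearMap.prod S.toLinearMap)).toLinearPMap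

theorem symm_left (H : IsRepresentingPair R S k) (x y : E) : ⟪R x, y⟫_ℂ = ⟪x, R y⟫_ℂ :=
  (R.nonneg_iff_isPositive.1 H.nonneg_left).inner_left_eq_inner_right x y

theorem symm_right (H : IsRepresentingPair R S k) (x y : E) : ⟪S x, y⟫_ℂ = ⟪x, S y⟫_ℂ :=
  (S.nonneg_iff_isPositive.1 H.nonneg_right).inner_left_eq_inner_right x y

theorem comm_apply (H : IsRepresentingPair R S k) (x : E) : R (S x) = S (R x) :=
  DFunLike.congr_fun H.comm.eq x

theorem mem_graph_quotient (H : IsRepresentingPair R S k) (x y : E) :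
    (x, y) ∈ (quotient R S).graph ↔ ∃ w, R w = x ∧ S w = y := by
  have hg : (quotient R S).graph = LinearMap.range (R.toLinearMap.prod S.toLinearMap) := by
    refine Submodule.toLinearPMap_graph_eq _ ?_
    rintro _ ⟨w, rfl⟩ hw
    have hw0 : w = 0 := H.injective w hw
    simp [hw0]
  rw [hg, LinearMap.mem_range]
  simp [Prod.ext_iff]

theorem apply_eq_iff (H : IsRepresentingPair R S k) (x y : E) :
    R y = S x ↔ ∃ w, R w = x ∧ S w = y := by
  constructor
  · intro h
    refine ⟨S y + (k : ℂ) • R x, ?_, ?_⟩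
    · rw [map_add, map_smul, H.comm_apply, h, H.add_eq]
    · rw [map_add, map_smul, ← H.comm_apply, ← h, H.add_eq]
  · rintro ⟨w, rfl, rfl⟩
    exact H.comm_apply w

theorem mem_graph_comp_quotient (H : IsRepresentingPair R S k) (x z : E) :
    (x, z) ∈ (comp (quotient R S) (quotient R S) : E →ₗ.[ℂ] E).graph ↔
      ∃ w, R (R w) = x ∧ S (S w) = z := by
  simp only [mem_graph_comp, H.mem_graph_quotient]
  constructor
  · rintro ⟨_, ⟨u, rfl, rfl⟩, v, hv, rfl⟩
    obtain ⟨w, rfl, rfl⟩ := (H.apply_eq_iff u v).1 hv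
    exact ⟨w, rfl, rfl⟩
  · rintro ⟨w, rfl, rfl⟩
    exact ⟨_, ⟨R w, rfl, rfl⟩, S w, H.comm_apply w, rfl⟩

end IsRepresentingPair

variable [CompleteSpace E]

theorem mem_graph_adjoint_iff {F : Type*} [NormedAddCommGroup F] [InnerProductSpace ℂ F]
    {A : E →ₗ.[ℂ] F} (hA : Dense (A.domain : Set E)) (x : F) (y : E) :
    (x, y) ∈ A.adjoint.graph ↔ ∀ a b, (a, b) ∈ A.graph → ⟪b, x⟫_ℂ = ⟪a, y⟫_ℂ := by
  simp only [LinearPMap.adjoint_graph_eq_graph_adjoint hA, Submodule.mem_adjoint_iff, sub_eq_zero]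

theorem mem_graph_iff_of_isSelfAdjoint {A : E →ₗ.[ℂ] E} (hA : IsSelfAdjoint A) (x y : E) :
    (x, y) ∈ A.graph ↔ ∀ a b, (a, b) ∈ A.graph → ⟪b, x⟫_ℂ = ⟪a, y⟫_ℂ := by
  rw [← mem_graph_adjoint_iff hA.dense_domain, LinearPMap.isSelfAdjoint_def.1 hA]

theorem IsPositiveSelfAdjoint.re_inner_nonneg {A : E →ₗ.[ℂ] E} (hA : IsPositiveSelfAdjoint A)
    {x y : E} (h : (x, y) ∈ A.graph) : 0 ≤ RCLike.re ⟪x, y⟫_ℂ := by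
  obtain ⟨a, rfl, rfl⟩ := (LinearPMap.mem_graph_iff _).1 h
  exact hA.2 a

namespace IsRepresentingPair

variable {R S : E →L[ℂ] E} {k : ℝ}

theorem dense_range (H : IsRepresentingPair R S k) : DenseRange R := by
  change Dense (LinearMap.range R.toLinearMap : Set E)
  rw [Submodule.dense_iff_topologicalClosure_eq_top,
    Submodule.topologicalClosure_eq_top_iff, Submodule.eq_bot_iff]
  intro v hv
  refine H.injective v ?_
  have h0 : ⟪R (R v), v⟫_ℂ = 0 := hv _ (LinearMap.mem_range_self R.toLinearMap (R v))
  rwa [H.symm_left, inner_self_eq_zero] at h0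

theorem isPositiveSelfAdjoint_quotient (H : IsRepresentingPair R S k) :
    IsPositiveSelfAdjoint (quotient R S) := by
  have hdom : ((quotient R S).domain : Set E) = Set.range R := by
    ext x
    simp [LinearPMap.mem_domain_iff, H.mem_graph_quotient]
  have hdense : Dense ((quotient R S).domain : Set E) := hdom ▸ H.dense_range
  refine ⟨LinearPMap.isSelfAdjoint_def.2 (LinearPMap.eq_of_eq_graph ?_), fun x => ?_⟩
  · ext ⟨x, y⟩
    rw [mem_graph_adjoint_iff hdense, H.mem_graph_quotient, ← H.apply_eq_iff]
    constructor
    · intro h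
      refine ext_inner_left ℂ fun w => ?_
      rw [← H.symm_left, ← H.symm_right]
      exact (h (R w) (S w) ((H.mem_graph_quotient _ _).2 ⟨w, rfl, rfl⟩)).symm
    · intro h a b hab
      obtain ⟨w, rfl, rfl⟩ := (H.mem_graph_quotient _ _).1 hab
      rw [H.symm_left, H.symm_right, h]
  · obtain ⟨w, h1, h2⟩ := (H.mem_graph_quotient _ _).1 ((quotient R S).mem_graph x)
    rw [← h1, ← h2, H.symm_left]
    exact (ContinuousLinearMap.nonneg_iff_isPositive _).1
      (H.comm.mul_nonneg H.nonneg_left H.nonneg_right) |>.re_inner_nonneg_right w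

theorem mem_graph_of_mem_graph_sqrt (H : IsRepresentingPair R S k) {A B : E →ₗ.[ℂ] E}
    (hA : ∀ x z, (x, z) ∈ A.graph ↔ ∃ w, R (R w) = x ∧ S (S w) = z) (hB : IsPosSqrt A B)
    {a b : E} (hab : (a, b) ∈ B.graph) : R b = S a := by
  have hA' : ∀ x z, (∃ y, (x, y) ∈ B.graph ∧ (y, z) ∈ B.graph) ↔
      ∃ w, R (R w) = x ∧ S (S w) = z := fun x z => by
    rw [← mem_graph_comp, hB.2, hA]
  have hsymm : ∀ {a b c d : E}, (a, b) ∈ B.graph → (c, d) ∈ B.graph → ⟪b, c⟫_ℂ = ⟪a, d⟫_ℂ :=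
    fun h1 h2 => (mem_graph_iff_of_isSelfAdjoint hB.1.1 _ _).1 h2 _ _ h1
  choose m hm1 hm2 using fun w => (hA' (R (R w)) (S (S w))).2 ⟨w, rfl, rfl⟩
  let M : E →ₗ[ℂ] E :=
    { toFun := m
      map_add' := fun x y => by
        refine B.mem_graph_snd_inj' (hm1 (x + y)) (B.graph.add_mem (hm1 x) (hm1 y)) ?_
        simp
      map_smul' := fun c x => by
        refine B.mem_graph_snd_inj' (hm1 (c • x)) (B.graph.smul_mem c (hm1 x)) ?_
        simp }
  have hM1 : ∀ w, (R (R w), M w) ∈ B.graph := hm1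
  have hM2 : ∀ w, (M w, S (S w)) ∈ B.graph := hm2
  have hMsymm : M.IsSymmetric := fun x y => by
    calc ⟪M x, y⟫_ℂ = ⟪M x, S (S y) + (k : ℂ) • R (R y)⟫_ℂ := by rw [H.add_eq]
      _ = ⟪S (S x) + (k : ℂ) • R (R x), M y⟫_ℂ := by
        rw [inner_add_right, inner_add_left, inner_smul_right, inner_smul_left,
          hsymm (hM2 x) (hM2 y), hsymm (hM1 x) (hM1 y), Complex.conj_ofReal]
      _ = ⟪x, M y⟫_ℂ := by rw [H.add_eq]
  have hMpos : ∀ x, 0 ≤ RCLike.re ⟪M x, x⟫_ℂ := fun x => by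
    rw [show ⟪M x, x⟫_ℂ = ⟪M x, S (S x) + (k : ℂ) • R (R x)⟫_ℂ by rw [H.add_eq],
      inner_add_right, inner_smul_right, map_add]
    refine add_nonneg (hB.1.re_inner_nonneg (hM2 x)) ?_
    have h1 := hB.1.re_inner_nonneg (hM1 x)
    rw [inner_re_symm] at h1
    simpa using mul_nonneg H.nonneg_coeff h1
  have hMapply : ∀ {a b}, (a, b) ∈ B.graph → M a = R (R b) := fun {a b} hab => by
    have e : S (S a) = a - (k : ℂ) • R (R a) := eq_sub_of_add_eq (H.add_eq a)
    have h1 : (S (S a), b - (k : ℂ) • M a) ∈ B.graph := by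
      rw [e]
      exact B.graph.sub_mem hab (B.graph.smul_mem (k : ℂ) (hM1 a))
    obtain ⟨w, hw1, hw2⟩ := (hA' (M a) (b - (k : ℂ) • M a)).1 ⟨_, hM2 a, h1⟩
    have hw : w = b := by
      rw [← H.add_eq w, hw1, hw2, sub_add_cancel]
    rw [← hw1, hw]
  let N : E →L[ℂ] E := ⟨M, hMsymm.continuous⟩
  have hN : 0 ≤ N := N.nonneg_iff_isPositive.2 ⟨hMsymm, hMpos⟩
  have hNRS : N = R * S := by
    refine (CFC.mul_self_eq_mul_self_iff N (R * S) hN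
      (H.comm.mul_nonneg H.nonneg_left H.nonneg_right)).1 ?_
    ext x
    change M (M x) = R (S (R (S x)))
    rw [hMapply (hM2 x), ← H.comm_apply (S x)]
  have h1 : R (S a) = R (R b) := by
    rw [← hMapply hab]
    exact (DFunLike.congr_fun hNRS a).symm
  rw [← sub_eq_zero, ← map_sub] at h1
  exact (sub_eq_zero.1 (H.injective _ h1)).symm

theorem isPosSqrt_iff (H : IsRepresentingPair R S k) {A : E →ₗ.[ℂ] E}
    (hA : ∀ x z, (x, z) ∈ A.graph ↔ ∃ w, R (R w) = x ∧ S (S w) = z) (B : E →ₗ.[ℂ] E) :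
    IsPosSqrt A B ↔ B = quotient R S := by
  constructor
  · intro hB
    have hle : ∀ {a b}, (a, b) ∈ B.graph → (a, b) ∈ (quotient R S).graph := fun hab =>
      (H.mem_graph_quotient _ _).2
        ((H.apply_eq_iff _ _).1 (H.mem_graph_of_mem_graph_sqrt hA hB hab))
    refine LinearPMap.eq_of_eq_graph (le_antisymm (fun _ => hle) ?_)
    rintro ⟨x, y⟩ hxy
    exact (mem_graph_iff_of_isSelfAdjoint hB.1.1 _ _).2 fun a b hab =>
      (mem_graph_iff_of_isSelfAdjoint H.isPositiveSelfAdjoint_quotient.1 _ _).1 hxy _ _ (hle hab)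
  · rintro rfl
    refine ⟨H.isPositiveSelfAdjoint_quotient, LinearPMap.eq_of_eq_graph ?_⟩
    ext ⟨x, z⟩
    rw [H.mem_graph_comp_quotient, hA]

theorem existsUnique_isPosSqrt (H : IsRepresentingPair R S k) {A : E →ₗ.[ℂ] E}
    (hA : ∀ x z, (x, z) ∈ A.graph ↔ ∃ w, R (R w) = x ∧ S (S w) = z) :
    ∃! B, IsPosSqrt A B :=
  ⟨quotient R S, (H.isPosSqrt_iff hA _).2 rfl, fun B hB => (H.isPosSqrt_iff hA B).1 hB⟩

theorem mem_graph_posSqrt (H : IsRepresentingPair R S k) {A : E →ₗ.[ℂ] E}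
    (hA : ∀ x z, (x, z) ∈ A.graph ↔ ∃ w, R (R w) = x ∧ S (S w) = z) (x y : E) :
    (x, y) ∈ (posSqrt A).graph ↔ ∃ w, R w = x ∧ S w = y := by
  have hex := (H.existsUnique_isPosSqrt hA).exists
  have h1 : posSqrt A = quotient R S := by
    rw [posSqrt, dif_pos hex]
    exact (H.isPosSqrt_iff hA _).1 hex.choose_spec
  rw [h1, H.mem_graph_quotient]

end IsRepresentingPair

/-- The square root of a bounded operator given by the continuous functional calculus. -/
def clmSqrt (T : E →L[ℂ] E) : E →L[ℂ] E := CFC.sqrt T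

theorem clmSqrt_nonneg (T : E →L[ℂ] E) : 0 ≤ clmSqrt T := CFC.sqrt_nonneg T

theorem clmSqrt_clmSqrt {T : E →L[ℂ] E} (hT : 0 ≤ T) (x : E) :
    clmSqrt T (clmSqrt T x) = T x :=
  DFunLike.congr_fun (CFC.sqrt_mul_sqrt_self T hT) x

theorem commute_clmSqrt {T T' : E →L[ℂ] E} (h : Commute T T') :
    Commute (clmSqrt T) (clmSqrt T') :=
  ((h.cfcₙ_nnreal NNReal.sqrt).symm.cfcₙ_nnreal NNReal.sqrt).symm

end Sqrt

theorem IsRepresentingPair.conj {E F : Type*} [NormedAddCommGroup E] [InnerProductSpace ℂ E]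
    [CompleteSpace E] [NormedAddCommGroup F] [InnerProductSpace ℂ F] [CompleteSpace F] {R S : F →L[ℂ] F} {k : ℝ}
    (H : IsRepresentingPair R S k) (U : E ≃ₗᵢ[ℂ] F) :
    IsRepresentingPair
      ((U.symm.toContinuousLinearEquiv : F →L[ℂ] E) ∘L R ∘L (U.toContinuousLinearEquiv : E →L[ℂ] F))
      ((U.symm.toContinuousLinearEquiv : F →L[ℂ] E) ∘L S ∘L (U.toContinuousLinearEquiv : E →L[ℂ] F))
      k := by
  have hpos : ∀ T : F →L[ℂ] F, 0 ≤ T → 0 ≤ (U.symm.toContinuousLinearEquiv : F →L[ℂ] E) ∘L T ∘L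
      (U.toContinuousLinearEquiv : E →L[ℂ] F) := fun T hT => by
    rw [ContinuousLinearMap.nonneg_iff_isPositive] at hT ⊢
    have hU : ∀ (x : F) (y : E), ⟪U.symm x, y⟫_ℂ = ⟪x, U y⟫_ℂ := fun x y => by
      rw [← U.inner_map_map, U.apply_symm_apply]
    have hU' : ∀ (x : E) (y : F), ⟪x, U.symm y⟫_ℂ = ⟪U x, y⟫_ℂ := fun x y => by
      rw [← U.inner_map_map, U.apply_symm_apply]
    refine ⟨fun x y => ?_, fun x => ?_⟩
    · change ⟪U.symm (T (U x)), y⟫_ℂ = ⟪x, U.symm (T (U y))⟫_ℂ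
      rw [hU, hU', hT.inner_left_eq_inner_right]
    · change 0 ≤ RCLike.re ⟪U.symm (T (U x)), x⟫_ℂ
      rw [hU]
      exact hT.re_inner_nonneg_left (U x)
  refine ⟨hpos R H.nonneg_left, hpos S H.nonneg_right, ?_, fun x hx => ?_, H.nonneg_coeff,
    fun x => ?_⟩
  · ext x
    change U.symm (R (U (U.symm (S (U x))))) = U.symm (S (U (U.symm (R (U x)))))
    rw [U.apply_symm_apply, U.apply_symm_apply, H.comm_apply]
  · have h1 : U.symm (R (U x)) = 0 := hx
    exact U.map_eq_zero_iff.1 (H.injective _ (U.symm.map_eq_zero_iff.1 h1))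
  · change U.symm (S (U (U.symm (S (U x))))) + (k : ℂ) • U.symm (R (U (U.symm (R (U x))))) = x
    rw [U.apply_symm_apply, U.apply_symm_apply, ← map_smul, ← map_add, H.add_eq,
      U.symm_apply_apply]

section AntiAdjoint

variable {E F : Type*} [NormedAddCommGroup E] [InnerProductSpace ℂ E]
  [NormedAddCommGroup F] [InnerProductSpace ℂ F]

theorem antiAdjoint_apply_eq_iff (T : E →ₛₗ.[starRingEnd ℂ] F) (hT : Dense (T.domain : Set E))
    (y : (antiAdjoint T hT).domain) (w : E) :
    antiAdjoint T hT y = w ↔ ∀ x : T.domain, ⟪(y : F), T x⟫_ℂ = ⟪(x : E), w⟫_ℂ := by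
  constructor
  · rintro rfl
    exact y.2.choose_spec
  · intro h
    refine hT.eq_of_inner_right ℂ fun x hx => ?_
    exact (y.2.choose_spec ⟨x, hx⟩).symm.trans (h ⟨x, hx⟩)

end AntiAdjoint

end PartialOp

namespace GenericPair

open PartialOp

variable {h : Type*} [NormedAddCommGroup h] [InnerProductSpace ℂ h] [CompleteSpace h]
  (S : GenericPair h)

/-- The orthogonal projection onto `q`, restricted to `p`. -/
def Qp : S.p →L[ℂ] S.q := S.q.orthogonalProjectionOnto ∘L S.p.subtypeL

theorem inner_Pq (x : S.q) (f : S.p) : ⟪S.Pq x, f⟫_ℂ = ⟪(x : h), (f : h)⟫_ℂ :=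
  Submodule.inner_orthogonalProjectionOnto_eq_of_mem_right f (x : h)

theorem inner_Qp (f : S.p) (x : S.q) : ⟪S.Qp f, x⟫_ℂ = ⟪(f : h), (x : h)⟫_ℂ :=
  Submodule.inner_orthogonalProjectionOnto_eq_of_mem_right x (f : h)

theorem inner_Pq_eq_inner_Qp (x : S.q) (f : S.p) : ⟪S.Pq x, f⟫_ℂ = ⟪x, S.Qp f⟫_ℂ := by
  rw [inner_Pq, ← inner_conj_symm, ← inner_Qp, inner_conj_symm]

theorem Qp_injective (f : S.p) (hf : S.Qp f = 0) : f = 0 := by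
  have h1 : (f : h) ∈ S.p ⊓ S.qᗮ :=
    ⟨f.2, Submodule.orthogonalProjectionOnto_eq_zero_iff.1 hf⟩
  rw [S.p_inf_q_orthogonal] at h1
  exact Subtype.ext ((Submodule.mem_bot ℂ).1 h1)

theorem denseRange_Qp : DenseRange S.Qp := by
  change Dense (LinearMap.range S.Qp.toLinearMap : Set S.q)
  rw [Submodule.dense_iff_topologicalClosure_eq_top,
    Submodule.topologicalClosure_eq_top_iff, Submodule.eq_bot_iff]
  intro v hv
  have h0 : ⟪S.Qp (S.Pq v), v⟫_ℂ = 0 := hv _ (LinearMap.mem_range_self S.Qp.toLinearMap _)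
  rw [← inner_conj_symm, ← inner_Pq_eq_inner_Qp, map_eq_zero, inner_self_eq_zero] at h0
  exact (injective_iff_map_eq_zero S.Pq).1 S.Pq_injective v h0

/-- The compression `P Q P` of the projection onto `q` to `p`. -/
def PQP : S.p →L[ℂ] S.p := S.Pq ∘L S.Qp

theorem inner_PQP (f g : S.p) : ⟪S.PQP f, g⟫_ℂ = ⟪S.Qp f, S.Qp g⟫_ℂ :=
  S.inner_Pq_eq_inner_Qp _ _

theorem PQP_nonneg : 0 ≤ S.PQP := by
  refine (ContinuousLinearMap.nonneg_iff_isPositive _).2 ⟨fun f g => ?_, fun f => ?_⟩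
  · change ⟪S.PQP f, g⟫_ℂ = ⟪f, S.PQP g⟫_ℂ
    rw [← inner_conj_symm f, inner_PQP, inner_PQP, inner_conj_symm]
  · change 0 ≤ RCLike.re ⟪S.PQP f, f⟫_ℂ
    rw [inner_PQP]
    exact inner_self_nonneg

theorem one_sub_PQP_nonneg : 0 ≤ 1 - S.PQP := by
  refine (ContinuousLinearMap.nonneg_iff_isPositive _).2 ⟨?_, fun f => ?_⟩
  · exact ContinuousLinearMap.isPositive_one.isSymmetric.sub
      ((ContinuousLinearMap.nonneg_iff_isPositive _).1 S.PQP_nonneg).isSymmetric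
  · change 0 ≤ RCLike.re ⟪f - S.PQP f, f⟫_ℂ
    rw [inner_sub_left, inner_PQP, map_sub, inner_self_eq_norm_sq, inner_self_eq_norm_sq,
      sub_nonneg]
    exact pow_le_pow_left₀ (norm_nonneg _)
      (Submodule.norm_orthogonalProjectionOnto_apply_le S.q (f : h)) 2

/-- The positive square root of `P Q P` on `p`. -/
def sqrtPQP : S.p →L[ℂ] S.p := clmSqrt S.PQP

/-- The positive square root of `1 - P Q P` on `p`. -/
def sqrtOneSubPQP : S.p →L[ℂ] S.p := clmSqrt (1 - S.PQP)

theorem sqrtPQP_sqrtPQP (f : S.p) : S.sqrtPQP (S.sqrtPQP f) = S.PQP f :=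
  clmSqrt_clmSqrt S.PQP_nonneg f

theorem sqrtOneSubPQP_sqrtOneSubPQP (f : S.p) :
    S.sqrtOneSubPQP (S.sqrtOneSubPQP f) = f - S.PQP f :=
  clmSqrt_clmSqrt S.one_sub_PQP_nonneg f

theorem sqrtPQP_injective (f : S.p) (hf : S.sqrtPQP f = 0) : f = 0 := by
  have h1 : S.Pq (S.Qp f) = 0 := by
    change S.PQP f = 0
    rw [← sqrtPQP_sqrtPQP, hf, map_zero]
  exact S.Qp_injective f ((injective_iff_map_eq_zero S.Pq).1 S.Pq_injective _ h1)

theorem isRepresentingPair_Delta : IsRepresentingPair S.sqrtPQP S.sqrtOneSubPQP 1 where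
  nonneg_left := clmSqrt_nonneg _
  nonneg_right := clmSqrt_nonneg _
  comm := commute_clmSqrt ((Commute.one_right _).sub_right (Commute.refl _))
  injective := S.sqrtPQP_injective
  nonneg_coeff := zero_le_one
  add_eq f := by simp [sqrtPQP_sqrtPQP, sqrtOneSubPQP_sqrtOneSubPQP]

theorem isRepresentingPair_oneAddDelta : IsRepresentingPair S.sqrtPQP 1 0 where
  nonneg_left := clmSqrt_nonneg _
  nonneg_right := (ContinuousLinearMap.nonneg_iff_isPositive _).2 ContinuousLinearMap.isPositive_one
  comm := Commute.one_right _
  injective := S.sqrtPQP_injective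
  nonneg_coeff := le_rfl
  add_eq f := by simp

theorem norm_Qp (f : S.p) : ‖S.Qp f‖ = ‖S.sqrtPQP f‖ := by
  have h1 : ⟪S.sqrtPQP f, S.sqrtPQP f⟫_ℂ = ⟪S.Qp f, S.Qp f⟫_ℂ := by
    rw [← S.isRepresentingPair_Delta.symm_left, sqrtPQP_sqrtPQP, inner_PQP]
  rw [norm_eq_sqrt_re_inner (𝕜 := ℂ), norm_eq_sqrt_re_inner (𝕜 := ℂ), h1]

/-- The unitary part in the polar decomposition of `Pq`. -/
def polar : S.q ≃ₗᵢ[ℂ] S.p :=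
  ((LinearEquiv.refl ℂ S.p).extendOfIsometry S.sqrtPQP.toLinearMap S.Qp.toLinearMap
    S.isRepresentingPair_Delta.dense_range S.denseRange_Qp S.norm_Qp).symm

theorem polar_symm_sqrtPQP (f : S.p) : S.polar.symm (S.sqrtPQP f) = S.Qp f :=
  LinearEquiv.extend_eq (LinearEquiv.refl ℂ S.p) S.sqrtPQP.toLinearMap S.Qp.toLinearMap
    S.isRepresentingPair_Delta.dense_range ⟨1, fun x => by rw [one_mul]; exact (S.norm_Qp x).le⟩
    S.denseRange_Qp ⟨1, fun x => by rw [one_mul]; exact (S.norm_Qp x).ge⟩ f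

theorem sqrtPQP_polar (x : S.q) : S.sqrtPQP (S.polar x) = S.Pq x := by
  refine ext_inner_right ℂ fun f => ?_
  rw [S.isRepresentingPair_Delta.symm_left, inner_Pq_eq_inner_Qp, ← polar_symm_sqrtPQP,
    ← S.polar.inner_map_map x, S.polar.apply_symm_apply]

theorem Qp_Pq (x : S.q) : S.Qp (S.Pq x) = S.polar.symm (S.PQP (S.polar x)) := by
  rw [← sqrtPQP_polar, ← polar_symm_sqrtPQP, sqrtPQP_sqrtPQP]

theorem mem_graph_phi (x : S.q) (y : S.qᗮ) :
    (x, y) ∈ S.phi.graph ↔ (x : h) + (y : h) ∈ S.p := by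
  rw [graph_phi]
  change S.pᗮ.starProjection ((x : h) + (y : h)) = 0 ↔ _
  rw [Submodule.starProjection_apply_eq_zero_iff, Submodule.orthogonal_orthogonal]

theorem inner_add_sub (a z : S.q) (b y : S.qᗮ) :
    ⟪(a : h) + (b : h), (z : h) - (y : h)⟫_ℂ = ⟪a, z⟫_ℂ - ⟪b, y⟫_ℂ := by
  rw [inner_add_left, inner_sub_right, inner_sub_right,
    Submodule.inner_right_of_mem_orthogonal a.2 y.2, Submodule.inner_left_of_mem_orthogonal z.2 b.2,
    Submodule.coe_inner, Submodule.coe_inner]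
  ring

theorem mem_graph_adjoint_phi (y : S.qᗮ) (z : S.q) :
    (y, z) ∈ S.phi.adjoint.graph ↔ (z : h) - (y : h) ∈ S.pᗮ := by
  rw [mem_graph_adjoint_iff S.dense_phi]
  simp only [mem_graph_phi]
  constructor
  · intro H f hf
    have e : ((S.q.orthogonalProjectionOnto f : S.q) : h) +
        ((S.qᗮ.orthogonalProjectionOnto f : S.qᗮ) : h) = f :=
      Submodule.starProjection_add_starProjection_orthogonal f
    have h1 := H _ _ (e.symm ▸ hf)
    rw [← e, inner_add_sub, h1, sub_self]
  · intro H a b hab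
    have h1 := H _ hab
    rw [inner_add_sub] at h1
    exact (sub_eq_zero.1 h1).symm

theorem mem_graph_adjoint_phi_comp_phi (x z : S.q) :
    (x, z) ∈ (comp S.phi.adjoint S.phi : S.q →ₗ.[ℂ] S.q).graph ↔
      ∃ w, S.Qp (S.Pq w) = x ∧ w - S.Qp (S.Pq w) = z := by
  simp only [mem_graph_comp, mem_graph_phi, mem_graph_adjoint_phi]
  constructor
  · rintro ⟨y, h1, h2⟩
    have e1 : S.Pq (x + z) = ⟨_, h1⟩ := by
      refine Subtype.ext (Submodule.eq_starProjection_of_mem_of_inner_eq_zero h1 fun w hw => ?_)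
      have e : ((x + z : S.q) : h) - ((x : h) + (y : h)) = (z : h) - (y : h) := by
        rw [Submodule.coe_add]; abel
      change ⟪((x + z : S.q) : h) - ((x : h) + (y : h)), w⟫_ℂ = 0
      rw [e]
      exact Submodule.inner_left_of_mem_orthogonal hw h2
    have e2 : S.Qp ⟨_, h1⟩ = x := by
      refine Subtype.ext (Submodule.eq_starProjection_of_mem_of_inner_eq_zero x.2 fun w hw => ?_)
      change ⟪(x : h) + (y : h) - (x : h), w⟫_ℂ = 0
      rw [add_sub_cancel_left]
      exact Submodule.inner_left_of_mem_orthogonal hw y.2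
    exact ⟨x + z, by rw [e1, e2], by rw [e1, e2, add_sub_cancel_left]⟩
  · rintro ⟨w, rfl, rfl⟩
    have e : ((S.Qp (S.Pq w) : S.q) : h) +
        ((S.qᗮ.orthogonalProjectionOnto (S.Pq w : h) : S.qᗮ) : h) = S.Pq w :=
      Submodule.starProjection_add_starProjection_orthogonal (S.Pq w : h)
    refine ⟨S.qᗮ.orthogonalProjectionOnto (S.Pq w : h), ?_, ?_⟩
    · rw [e]
      exact (S.Pq w).2
    · rw [Submodule.coe_sub, sub_sub, e]
      exact Submodule.sub_starProjection_mem_orthogonal (w : h)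

theorem inner_Pq_Γq (x x' : S.q) :
    ⟪S.Pq (S.Γq x), S.Pq (S.Γq x')⟫_ℂ = ⟪x', x - S.Qp (S.Pq x)⟫_ℂ := by
  have h1 : S.Γ (S.Pq (S.Γq x) : h) = (x : h) - (S.Pq x : h) := by
    refine eq_sub_of_add_eq' (Eq.trans ?_ (S.basis x))
    rfl
  rw [← inner_conj_symm, inner_Pq, inner_conj_symm, inner_sub_right, ← inner_Pq_eq_inner_Qp,
    inner_Pq, Submodule.coe_inner, ← inner_sub_right, ← h1, ← S.inner_Γ,
    show S.Γ (S.Γq x' : h) = x' from S.Γ_Γ x']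

theorem mem_graph_Delta (f z : S.p) :
    (f, z) ∈ S.Delta.graph ↔ ∃ w, S.PQP w = f ∧ w - S.PQP w = z := by
  have key : ∀ x : S.q, ∀ z : S.p,
      (∀ x' : S.beta.domain, ⟪S.Pq (S.Γq x), S.beta x'⟫_ℂ = ⟪(x' : S.p), z⟫_ℂ) ↔
        S.Qp (S.Pq x + z) = x := by
    intro x z
    have h1 : (∀ x' : S.beta.domain, ⟪S.Pq (S.Γq x), S.beta x'⟫_ℂ = ⟪(x' : S.p), z⟫_ℂ) ↔
        ∀ x' : S.q, ⟪x', x - S.Qp (S.Pq x)⟫_ℂ = ⟪x', S.Qp z⟫_ℂ := by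
      simp only [← inner_Pq_Γq, ← inner_Pq_eq_inner_Qp]
      constructor
      · intro H x'
        have h2 := H ⟨S.Pq x', LinearMap.mem_range_self S.Pq.toLinearMap x'⟩
        rwa [beta_apply] at h2
      · rintro H ⟨_, x', rfl⟩
        exact (congrArg _ (S.beta_apply x')).trans (H x')
    rw [h1, map_add]
    constructor
    · intro H
      rw [← ext_inner_left ℂ H, add_sub_cancel]
    · intro H x'
      rw [← eq_sub_of_add_eq' H]
  constructor
  · intro H
    obtain ⟨⟨_, ⟨x, rfl⟩, hx⟩, rfl, rfl⟩ := (LinearPMap.mem_graph_iff _).1 H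
    have h1 := (antiAdjoint_apply_eq_iff S.beta S.dense_beta ⟨_, hx⟩ _).1 rfl
    have h2 := (key x _).1 fun x' => by
      rw [← beta_apply]
      exact h1 x'
    have h3 : S.PQP (S.Pq x + antiAdjoint S.beta S.dense_beta ⟨_, hx⟩) = S.Pq x :=
      congrArg S.Pq h2
    exact ⟨_, h3, by rw [h3, add_sub_cancel_left]; rfl⟩
  · rintro ⟨w, rfl, rfl⟩
    have h1 := (key (S.Qp w) (w - S.PQP w)).2 (congrArg S.Qp (add_sub_cancel (S.PQP w) w))
    have hdom : S.PQP w ∈ S.beta.domain := LinearMap.mem_range_self S.Pq.toLinearMap (S.Qp w)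
    have hb : S.beta ⟨S.PQP w, hdom⟩ = S.Pq (S.Γq (S.Qp w)) := S.beta_apply (S.Qp w)
    have h2 : ∀ x' : S.beta.domain,
        ⟪S.beta ⟨S.PQP w, hdom⟩, S.beta x'⟫_ℂ = ⟪(x' : S.p), w - S.PQP w⟫_ℂ := by
      rw [hb]; exact h1
    have hdom' : S.beta ⟨S.PQP w, hdom⟩ ∈ (antiAdjoint S.beta S.dense_beta).domain := ⟨_, h2⟩
    refine (LinearPMap.mem_graph_iff _).2 ⟨⟨S.PQP w, hdom, hdom'⟩, rfl, ?_⟩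
    exact (antiAdjoint_apply_eq_iff S.beta S.dense_beta ⟨_, hdom'⟩ _).2 h2

theorem mem_graph_oneAddDelta (f z : S.p) :
    (f, z) ∈ S.oneAddDelta.graph ↔ ∃ w, S.PQP w = f ∧ w = z := by
  have h1 : (f, z) ∈ S.oneAddDelta.graph ↔ (f, z - f) ∈ S.Delta.graph := by
    constructor
    · intro H
      obtain ⟨x, rfl, rfl⟩ := (LinearPMap.mem_graph_iff _).1 H
      refine (LinearPMap.mem_graph_iff _).2 ⟨x, rfl, ?_⟩
      exact (add_sub_cancel_left (x : S.p) (S.Delta x)).symm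
    · intro H
      obtain ⟨x, rfl, hx⟩ := (LinearPMap.mem_graph_iff _).1 H
      refine (LinearPMap.mem_graph_iff _).2 ⟨x, rfl, ?_⟩
      exact (congrArg _ hx).trans (add_sub_cancel (x : S.p) z)
  rw [h1, mem_graph_Delta]
  constructor
  · rintro ⟨w, rfl, hw⟩
    exact ⟨w, rfl, sub_left_inj.1 hw⟩
  · rintro ⟨w, rfl, rfl⟩
    exact ⟨w, rfl, rfl⟩

end GenericPair

end

open PartialOp in
theorem mainTheorem6 {h : Type*} [NormedAddCommGroup h] [InnerProductSpace ℂ h] [CompleteSpace h]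
    (S : GenericPair h) :
    (∃! B, PartialOp.IsPosSqrt (PartialOp.comp S.phi.adjoint S.phi) B) ∧
    (∃! B, PartialOp.IsPosSqrt S.Delta B) ∧
    (∃! B, PartialOp.IsPosSqrt S.oneAddDelta B) ∧
    (∃ U : S.q ≃ₗᵢ[ℂ] S.p,
      S.W = U.toLinearEquiv.toLinearMap.toPMap ⊤ ∧
      (∀ x : S.absPhi.domain, ∃ hx : U x ∈ (PartialOp.posSqrt S.Delta).domain,
        U (S.absPhi x) = PartialOp.posSqrt S.Delta ⟨U x, hx⟩) ∧
      PartialOp.Implements U S.absPhi (PartialOp.posSqrt S.Delta)) ∧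
    PartialOp.UnitarilyEquivalent S.absPhi (PartialOp.posSqrt S.Delta) := by
  have hphi (x z : S.q) : (x, z) ∈ (comp S.phi.adjoint S.phi : S.q →ₗ.[ℂ] S.q).graph ↔
      ∃ w, S.polar.symm (S.sqrtPQP (S.polar (S.polar.symm (S.sqrtPQP (S.polar w))))) = x ∧
        S.polar.symm (S.sqrtOneSubPQP
          (S.polar (S.polar.symm (S.sqrtOneSubPQP (S.polar w))))) = z := by
    simp only [S.mem_graph_adjoint_phi_comp_phi, LinearIsometryEquiv.apply_symm_apply,
      S.sqrtPQP_sqrtPQP, S.sqrtOneSubPQP_sqrtOneSubPQP, S.Qp_Pq, map_sub,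
      LinearIsometryEquiv.symm_apply_apply]
  have hDelta (f z : S.p) : (f, z) ∈ S.Delta.graph ↔
      ∃ w, S.sqrtPQP (S.sqrtPQP w) = f ∧ S.sqrtOneSubPQP (S.sqrtOneSubPQP w) = z := by
    simp only [S.mem_graph_Delta, S.sqrtPQP_sqrtPQP, S.sqrtOneSubPQP_sqrtOneSubPQP]
  have hone (f z : S.p) : (f, z) ∈ S.oneAddDelta.graph ↔
      ∃ w, S.sqrtPQP (S.sqrtPQP w) = f ∧
        (1 : S.p →L[ℂ] S.p) ((1 : S.p →L[ℂ] S.p) w) = z := by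
    simp only [S.mem_graph_oneAddDelta, S.sqrtPQP_sqrtPQP, one_apply_eq_self]
  have Hphi := S.isRepresentingPair_Delta.conj S.polar
  have himp : Implements S.polar S.absPhi (posSqrt S.Delta) := by
    intro x y
    rw [S.isRepresentingPair_Delta.mem_graph_posSqrt hDelta]
    refine (Hphi.mem_graph_posSqrt hphi x y).trans ?_
    constructor
    · rintro ⟨w, rfl, rfl⟩
      exact ⟨S.polar w, (S.polar.apply_symm_apply _).symm, (S.polar.apply_symm_apply _).symm⟩
    · rintro ⟨w, h1, h2⟩
      refine ⟨S.polar.symm w, ?_, ?_⟩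
      · change S.polar.symm (S.sqrtPQP (S.polar (S.polar.symm w))) = x
        rw [S.polar.apply_symm_apply, h1, S.polar.symm_apply_apply]
      · change S.polar.symm (S.sqrtOneSubPQP (S.polar (S.polar.symm w))) = y
        rw [S.polar.apply_symm_apply, h2, S.polar.symm_apply_apply]
  refine ⟨Hphi.existsUnique_isPosSqrt hphi, S.isRepresentingPair_Delta.existsUnique_isPosSqrt hDelta,
    S.isRepresentingPair_oneAddDelta.existsUnique_isPosSqrt hone,
    ⟨S.polar, LinearPMap.eq_of_eq_graph ?_, fun x => ?_, himp⟩, S.polar, himp⟩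
  · ext ⟨x, y⟩
    have h1 : (x, y) ∈ S.W.graph ↔ S.polar x = y := by
      refine (mem_graph_comp _ _ x y).trans ?_
      simp only [S.isRepresentingPair_oneAddDelta.mem_graph_posSqrt hone,
        one_apply_eq_self]
      constructor
      · rintro ⟨f, hf, w, rfl, rfl⟩
        obtain ⟨a, rfl, ha⟩ := (LinearPMap.mem_graph_iff _).1 hf
        have h2 : S.sqrtPQP (S.polar a) = S.sqrtPQP w := (S.sqrtPQP_polar a).trans ha
        rw [← sub_eq_zero, ← map_sub] at h2
        exact sub_eq_zero.1 (S.sqrtPQP_injective _ h2)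
      · rintro rfl
        exact ⟨S.Pq x, (LinearPMap.mem_graph_iff _).2 ⟨⟨x, trivial⟩, rfl, rfl⟩, S.polar x,
          S.sqrtPQP_polar x, rfl⟩
    rw [h1]
    constructor
    · rintro rfl
      exact (LinearPMap.mem_graph_iff _).2 ⟨⟨x, trivial⟩, rfl, rfl⟩
    · intro hxy
      obtain ⟨a, rfl, ha⟩ := (LinearPMap.mem_graph_iff _).1 hxy
      exact ha
  · obtain ⟨a, ha, hb⟩ := (LinearPMap.mem_graph_iff _).1 ((himp _ _).1 (S.absPhi.mem_graph x))
    have ha' : S.polar x = a := ha.symm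
    refine ⟨ha' ▸ a.2, ?_⟩
    exact hb.symm.trans (congrArg _ (Subtype.ext ha))
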